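/- Let $\alpha>-1$. For $z>0$ let $\langle \ell,p\rangle=\int_0^z p(x)\,x^{\alpha}e^{-x}\,dx$ be the truncated Laguerre functional on real polynomials, and let $(P_n(x;z))_{n\ge 0}$ be its sequence of monic orthogonal polynomials, with three-term recurrence relation $$xP_n=P_{n+1}+b_n(z)P_n+a_n(z)P_{n-1},\qquad n\ge 0,\qquad P_{-1}=0,\quad a_0=0 .$$ Define $\sigma_n(z)$ by $P_n(x;z)=x^n-\sigma_n(z)x^{n-1}+\mathcal O(x^{n-2})$ (with $\sigma_0=0$), and put $$R_n(z)=\frac{b_n(z)-(2n+\alpha+1)}{z},\qquad r_n(z)=\frac{a_n(z)-\sigma_n(z)}{z},\qquad \vartheta=z\,\frac{d}{dz}.$$ Then for all $n\ge 0$ and all $z>0$ $$r_n^2=a_nR_nR_{n-1},$$ $$r_{n+1}+r_n=-(2n+1+\alpha-z+zR_n)R_n,$$ $$(r_n+n)(r_n+n+\alpha)=a_n(R_n-1)(R_{n-1}-1),$$ where for $n=0$ the value of $R_{-1}$ is immaterial because $a_0=0$. Moreover, for all $n\ge 0$ the functions $R_n$ and $r_n$ are differentiable on $(0,\infty)$,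 $R_n(z)\notin\{0,1\}$ for all $z>0$, and $$\vartheta R_n=2r_n+(2n+\alpha-z+zR_n)R_n,$$ $$\vartheta r_n=n(n+\alpha)+(2n+\alpha)r_n+\frac{r_n^2}{R_n}+\frac{(n+r_n)(n+\alpha+r_n)}{R_n-1}.$$ -/

import Mathlib

open scoped Polynomial

namespace TruncLaguerre

/-! ### Monic orthogonal polynomials of a functional on real polynomials -/

/-- `P` is the sequence of monic orthogonal polynomials with respect to the functional `L`:
`P n` is monic of degree `n`, and `L (P n * P m) = K n * δ_{n m}` with `K n ≠ 0`. -/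
structure IsSMOP (L : ℝ[X] → ℝ) (P : ℕ → ℝ[X]) : Prop where
  monic : ∀ n, (P n).Monic
  natDegree_eq : ∀ n, (P n).natDegree = n
  orthogonal : ∀ m n, m ≠ n → L (P n * P m) = 0
  norm_ne_zero : ∀ n, L (P n * P n) ≠ 0

/-- The Gram-Schmidt construction of the monic orthogonal polynomials of `L`. -/
noncomputable def monicOP (L : ℝ[X] → ℝ) : ℕ → ℝ[X]
  | n => Polynomial.X ^ n - ∑ k : Fin n,
      Polynomial.C (L (Polynomial.X ^ n * monicOP L k) / L (monicOP L k * monicOP L k)) *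
        monicOP L k
decreasing_by all_goals exact k.2

/-! ### The truncated Laguerre functional and the functions attached to it -/

/-- The truncated Laguerre functional `⟨ℓ, p⟩ = ∫₀ᶻ p(x) x^α e^{-x} dx`. -/
noncomputable def functional (α z : ℝ) (p : ℝ[X]) : ℝ :=
  ∫ x in (0 : ℝ)..z, p.eval x * (x ^ α * Real.exp (-x))

/-- The truncated Laguerre polynomials `P_n(x; z)`. -/
noncomputable def P (α : ℝ) (n : ℕ) (z : ℝ) : ℝ[X] :=
  monicOP (functional α z) n

/-- `h_n = ⟨ℓ, P_n²⟩`. -/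
noncomputable def h (α : ℝ) (n : ℕ) (z : ℝ) : ℝ :=
  functional α z (P α n z * P α n z)

/-- The coefficient `a_n` of `x P_n = P_{n+1} + b_n P_n + a_n P_{n-1}`, with `a_0 = 0`
(see `three_term_recurrence`). -/
noncomputable def a (α : ℝ) : ℕ → ℝ → ℝ
  | 0, _ => 0
  | n + 1, z => functional α z (Polynomial.X * P α (n + 1) z * P α n z) / h α n z

/-- The coefficient `b_n` of `x P_n = P_{n+1} + b_n P_n + a_n P_{n-1}`
(see `three_term_recurrence`). -/
noncomputable def b (α : ℝ) (n : ℕ) (z : ℝ) : ℝ :=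
  functional α z (Polynomial.X * P α n z * P α n z) / h α n z

/-- `σ_n`, defined by `P_n(x; z) = x^n - σ_n(z) x^{n-1} + O(x^{n-2})`, with `σ_0 = 0`. -/
noncomputable def sigma (α : ℝ) : ℕ → ℝ → ℝ
  | 0, _ => 0
  | n + 1, z => -(P α (n + 1) z).coeff n

/-- `R_n(z) = (b_n(z) - (2n + α + 1)) / z`. -/
noncomputable def R (α : ℝ) (n : ℕ) (z : ℝ) : ℝ :=
  (b α n z - (2 * n + α + 1)) / z

/-- `R_{n-1}(z)`. For `n = 0` the value is immaterial (it is set to `0`): wherever it occurs,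
it is multiplied by `a_0 = 0`. -/
noncomputable def RPred (α : ℝ) : ℕ → ℝ → ℝ
  | 0, _ => 0
  | n + 1, z => R α n z

/-- `r_n(z) = (a_n(z) - σ_n(z)) / z`. -/
noncomputable def r (α : ℝ) (n : ℕ) (z : ℝ) : ℝ :=
  (a α n z - sigma α n z) / z

/-- The differential operator `ϑ = z ∂_z`. -/
noncomputable def theta (f : ℝ → ℝ) (z : ℝ) : ℝ := z * deriv f z

/-! ### The definitions describe the intended objects -/

section General

variable {L : ℝ[X] →ₗ[ℝ] ℝ} {Q : ℕ → ℝ[X]}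

theorem apply_mul_eq_zero (hm : ∀ n, (Q n).Monic) (hd : ∀ n, (Q n).natDegree = n)
    (q : ℝ[X]) (N : ℕ) (hq : ∀ k < N, L (q * Q k) = 0) (p : ℝ[X]) (hp : p.degree < N) :
    L (q * p) = 0 := by
  induction N generalizing p with
  | zero =>
    have : p = 0 := by
      rw [← Polynomial.degree_eq_bot]
      simpa using hp
    simp [this]
  | succ N ih =>
    have h1 : (p - Polynomial.C (p.coeff N) * Q N).degree < N := by
      rw [Polynomial.degree_lt_iff_coeff_zero]
      intro m hmN
      rcases eq_or_lt_of_le hmN with rfl | hlt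
      · have : (Q N).coeff N = 1 := by
          have := hm N
          rw [Polynomial.Monic, Polynomial.leadingCoeff, hd] at this
          exact this
        simp [this]
      · have h2 : p.coeff m = 0 :=
          Polynomial.coeff_eq_zero_of_degree_lt (lt_of_lt_of_le hp (by exact_mod_cast hlt))
        have h3 : (Q N).coeff m = 0 :=
          Polynomial.coeff_eq_zero_of_natDegree_lt (by rw [hd]; exact hlt)
        simp [h2, h3]
    have h4 := ih (fun k hk => hq k (by omega)) _ h1
    have h5 := hq N (by omega)
    rw [mul_sub, map_sub, mul_left_comm, ← Polynomial.smul_eq_C_mul, map_smul, h5] at h4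
    simpa using h4

theorem eq_zero_of_orthogonal (hpos : ∀ p : ℝ[X], p ≠ 0 → L (p * p) ≠ 0)
    (hm : ∀ n, (Q n).Monic) (hd : ∀ n, (Q n).natDegree = n)
    (q : ℝ[X]) (N : ℕ) (hq : ∀ k < N, L (q * Q k) = 0) (hqd : q.degree < N) : q = 0 := by
  by_contra hne
  exact hpos q hne (apply_mul_eq_zero hm hd q N hq q hqd)

theorem monicOP_spec (hpos : ∀ p : ℝ[X], p ≠ 0 → L (p * p) ≠ 0) (n : ℕ) :
    (monicOP L n).Monic ∧ (monicOP L n).natDegree = n ∧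
      ∀ k < n, L (monicOP L n * monicOP L k) = 0 := by
  induction n using Nat.strong_induction_on with
  | _ n ih =>
    have hlt : (∑ k : Fin n,
        Polynomial.C (L (Polynomial.X ^ n * monicOP L k) / L (monicOP L k * monicOP L k)) *
          monicOP L k).degree < n := by
      rw [Polynomial.degree_lt_iff_coeff_zero]
      intro m hmn
      rw [Polynomial.finsetSum_coeff]
      refine Finset.sum_eq_zero fun k _ => ?_
      rw [Polynomial.coeff_C_mul, Polynomial.coeff_eq_zero_of_natDegree_lt, mul_zero]
      rw [(ih k k.2).2.1]
      exact lt_of_lt_of_le k.2 hmn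
    have hX : (Polynomial.X ^ n : ℝ[X]).degree = n := Polynomial.degree_X_pow n
    refine ⟨?_, ?_, ?_⟩
    · rw [monicOP]
      exact (Polynomial.monic_X_pow n).sub_of_left (by rw [hX]; exact hlt)
    · rw [monicOP]
      exact Polynomial.natDegree_eq_of_degree_eq_some
        ((Polynomial.degree_sub_eq_left_of_degree_lt (by rw [hX]; exact hlt)).trans hX)
    · intro j hj
      rw [monicOP, sub_mul, map_sub, Finset.sum_mul, map_sum,
        Finset.sum_eq_single (⟨j, hj⟩ : Fin n)]
      · rw [mul_assoc, ← Polynomial.smul_eq_C_mul, map_smul, smul_eq_mul,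
          div_mul_cancel₀ _ (hpos _ (ih j hj).1.ne_zero), sub_self]
      · intro k _ hk
        rw [mul_assoc, ← Polynomial.smul_eq_C_mul, map_smul]
        have hne : (k : ℕ) ≠ j := fun hkj => hk (Fin.ext hkj)
        rcases lt_or_gt_of_ne hne with hkj | hkj
        · rw [mul_comm (monicOP L k) (monicOP L j), (ih j hj).2.2 k hkj, smul_zero]
        · rw [(ih k k.2).2.2 j hkj, smul_zero]
      · intro hh
        exact absurd (Finset.mem_univ _) hh

theorem isSMOP_monicOP (hpos : ∀ p : ℝ[X], p ≠ 0 → L (p * p) ≠ 0) :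
    IsSMOP L (monicOP L) where
  monic n := (monicOP_spec hpos n).1
  natDegree_eq n := (monicOP_spec hpos n).2.1
  orthogonal m n hmn := by
    rcases lt_or_gt_of_ne hmn with hlt | hlt
    · exact (monicOP_spec hpos n).2.2 m hlt
    · rw [mul_comm]
      exact (monicOP_spec hpos m).2.2 n hlt
  norm_ne_zero n := hpos _ (monicOP_spec hpos n).1.ne_zero

theorem IsSMOP.unique (hpos : ∀ p : ℝ[X], p ≠ 0 → L (p * p) ≠ 0) {Q' : ℕ → ℝ[X]}
    (h1 : IsSMOP L Q) (h2 : IsSMOP L Q') : Q = Q' := by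
  have key : ∀ {S : ℕ → ℝ[X]}, IsSMOP L S → ∀ n : ℕ, ∀ p : ℝ[X], p.degree < n →
      L (S n * p) = 0 := fun hS n p hp =>
    apply_mul_eq_zero hS.monic hS.natDegree_eq _ n
      (fun k hk => hS.orthogonal k n (by omega)) p hp
  funext n
  have hdeg : ∀ {S : ℕ → ℝ[X]}, IsSMOP L S → ∀ n, (S n).degree = n := fun hS n => by
    rw [Polynomial.degree_eq_natDegree (hS.monic n).ne_zero, hS.natDegree_eq]
  have hlt : (Q n - Q' n).degree < n := by
    have := Polynomial.degree_sub_lt_left ((hdeg h1 n).trans (hdeg h2 n).symm) (h1.monic n).ne_zero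
      ((h1.monic n).leadingCoeff.trans (h2.monic n).leadingCoeff.symm)
    rwa [hdeg h1 n] at this
  refine sub_eq_zero.mp (by_contra fun hne => hpos _ hne ?_)
  rw [sub_mul, map_sub, key h1 n _ hlt, key h2 n _ hlt, sub_zero]

end General

theorem intervalIntegrable_weight {α : ℝ} (hα : -1 < α) (z : ℝ) (p : ℝ[X]) :
    IntervalIntegrable (fun x => p.eval x * (x ^ α * Real.exp (-x))) MeasureTheory.volume 0 z := by
  have h1 : IntervalIntegrable (fun x : ℝ => x ^ α) MeasureTheory.volume 0 z :=
    intervalIntegral.intervalIntegrable_rpow' hα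
  have h2 : Continuous fun x : ℝ => p.eval x * Real.exp (-x) := by fun_prop
  refine (h1.mul_continuousOn h2.continuousOn).congr (fun x _ => ?_)
  ring

/-- For `α > -1` the functional is linear. -/
theorem exists_linearMap {α : ℝ} (hα : -1 < α) (z : ℝ) :
    ∃ L : ℝ[X] →ₗ[ℝ] ℝ, ⇑L = functional α z := by
  refine ⟨{ toFun := functional α z, map_add' := fun p q => ?_, map_smul' := fun c p => ?_ }, rfl⟩
  · rw [functional, functional, functional, ← intervalIntegral.integral_add
      (intervalIntegrable_weight hα z p) (intervalIntegrable_weight hα z q)]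
    simp only [Polynomial.eval_add, add_mul]
  · simp only [functional, Polynomial.eval_smul, smul_eq_mul, RingHom.id_apply, mul_assoc]
    rw [intervalIntegral.integral_const_mul]

theorem functional_mul_self_pos {α z : ℝ} (hα : -1 < α) (hz : 0 < z) {p : ℝ[X]} (hp : p ≠ 0) :
    0 < functional α z (p * p) := by
  rw [functional, intervalIntegral.integral_pos_iff_support_of_nonneg_ae' _
    (intervalIntegrable_weight hα z (p * p))]
  · refine ⟨hz, ?_⟩
    have hfin : (p.roots.toFinset : Set ℝ).Finite := Finset.finite_toSet _
    have hsub : Set.Ioo 0 z \ (p.roots.toFinset : Set ℝ) ⊆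
        (Function.support fun x => (p * p).eval x * (x ^ α * Real.exp (-x))) ∩ Set.Ioc 0 z := by
      rintro x ⟨hx, hxr⟩
      have hev : p.eval x ≠ 0 := fun h0 => hxr (by simp [hp, h0])
      refine ⟨?_, hx.1, hx.2.le⟩
      simp only [Function.mem_support, Polynomial.eval_mul]
      exact mul_ne_zero (mul_ne_zero hev hev)
        (mul_ne_zero (Real.rpow_pos_of_pos hx.1 α).ne' (Real.exp_pos _).ne')
    refine lt_of_lt_of_le ?_ (MeasureTheory.measure_mono hsub)
    rw [MeasureTheory.measure_sdiff_null (hfin.measure_zero _), Real.volume_Ioo]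
    simpa using hz
  · rw [Set.uIoc_of_le hz.le]
    filter_upwards [MeasureTheory.ae_restrict_mem measurableSet_Ioc] with x hx
    simp only [Pi.zero_apply, Polynomial.eval_mul]
    exact mul_nonneg (mul_self_nonneg _)
      (mul_nonneg (Real.rpow_nonneg hx.1.le α) (Real.exp_pos _).le)

/-- `(P_n)` is the sequence of monic orthogonal polynomials of the functional. -/
theorem isSMOP {α z : ℝ} (hα : -1 < α) (hz : 0 < z) :
    IsSMOP (functional α z) (fun n => P α n z) := by
  obtain ⟨L, hL⟩ := exists_linearMap hα z
  have hpos : ∀ p : ℝ[X], p ≠ 0 → L (p * p) ≠ 0 := fun p hp => by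
    rw [hL]; exact (functional_mul_self_pos hα hz hp).ne'
  have := isSMOP_monicOP hpos
  rw [hL] at this
  exact this

/-- The sequence of monic orthogonal polynomials is unique. -/
theorem eq_of_isSMOP {α z : ℝ} (hα : -1 < α) (hz : 0 < z) {Q : ℕ → ℝ[X]}
    (hQ : IsSMOP (functional α z) Q) (n : ℕ) : Q n = P α n z := by
  obtain ⟨L, hL⟩ := exists_linearMap hα z
  have hpos : ∀ p : ℝ[X], p ≠ 0 → L (p * p) ≠ 0 := fun p hp => by
    rw [hL]; exact (functional_mul_self_pos hα hz hp).ne'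
  have hP := isSMOP hα hz
  rw [← hL] at hQ hP
  exact congrFun (IsSMOP.unique hpos hQ hP) n

/-- The three-term recurrence relation, with `P_{-1} = 0`. -/
theorem three_term_recurrence {α z : ℝ} (hα : -1 < α) (hz : 0 < z) :
    Polynomial.X * P α 0 z = P α 1 z + Polynomial.C (b α 0 z) * P α 0 z ∧
    ∀ n, Polynomial.X * P α (n + 1) z = P α (n + 2) z +
      Polynomial.C (b α (n + 1) z) * P α (n + 1) z + Polynomial.C (a α (n + 1) z) * P α n z := by
  obtain ⟨L, hL⟩ := exists_linearMap hα z
  have hpos : ∀ p : ℝ[X], p ≠ 0 → L (p * p) ≠ 0 := fun p hp => by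
    rw [hL]; exact (functional_mul_self_pos hα hz hp).ne'
  have hS := isSMOP hα hz
  rw [← hL] at hS
  have hlow : ∀ n : ℕ, ∀ p : ℝ[X], p.degree < n → L (P α n z * p) = 0 := fun n p hp =>
    apply_mul_eq_zero hS.monic hS.natDegree_eq _ n
      (fun k hk => hS.orthogonal k n (by omega)) p hp
  have hdeg : ∀ n, (P α n z).degree = n := fun n => by
    rw [Polynomial.degree_eq_natDegree (hS.monic n).ne_zero, hS.natDegree_eq n]
  have hXdeg : ∀ n, (Polynomial.X * P α n z).degree = ((n + 1 : ℕ) : WithBot ℕ) := fun n => by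
    rw [Polynomial.degree_mul, Polynomial.degree_X, hdeg n]
    push_cast
    exact add_comm _ _
  have hsub : ∀ n, (Polynomial.X * P α n z - P α (n + 1) z).degree < ((n + 1 : ℕ) : WithBot ℕ) :=
    fun n => by
      have := Polynomial.degree_sub_lt_left ((hXdeg n).trans (hdeg (n + 1)).symm)
        (mul_ne_zero Polynomial.X_ne_zero (hS.monic n).ne_zero)
        ((Polynomial.monic_X.mul (hS.monic n)).leadingCoeff.trans
          (hS.monic (n + 1)).leadingCoeff.symm)
      rwa [hXdeg n] at this
  have hb : ∀ n, b α n z * L (P α n z * P α n z) = L (Polynomial.X * P α n z * P α n z) :=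
    fun n => by
      rw [b, h, ← hL]
      exact div_mul_cancel₀ _ (hS.norm_ne_zero n)
  have ha : ∀ n, a α (n + 1) z * L (P α n z * P α n z) =
      L (Polynomial.X * P α (n + 1) z * P α n z) := fun n => by
    rw [a, h, ← hL]
    exact div_mul_cancel₀ _ (hS.norm_ne_zero n)
  have hC : ∀ (c : ℝ) (p q : ℝ[X]), L (Polynomial.C c * p * q) = c * L (p * q) := fun c p q => by
    rw [mul_assoc, ← Polynomial.smul_eq_C_mul, map_smul, smul_eq_mul]
  constructor
  · refine sub_eq_zero.mp (eq_zero_of_orthogonal hpos hS.monic hS.natDegree_eq _ 1 ?_ ?_)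
    · intro k hk
      obtain rfl : k = 0 := by omega
      rw [sub_mul, add_mul, map_sub, map_add, hC, hb, hS.orthogonal 0 1 (by omega)]
      ring
    · rw [← sub_sub]
      refine lt_of_le_of_lt (Polynomial.degree_sub_le _ _) (max_lt (hsub 0) ?_)
      rw [← Polynomial.smul_eq_C_mul]
      refine lt_of_le_of_lt (Polynomial.degree_smul_le _ _) ?_
      rw [hdeg]
      exact_mod_cast Nat.zero_lt_one
  · intro n
    refine sub_eq_zero.mp (eq_zero_of_orthogonal hpos hS.monic hS.natDegree_eq _ (n + 2) ?_ ?_)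
    · intro k hk
      rw [sub_mul, add_mul, add_mul, map_sub, map_add, map_add, hC, hC]
      rw [hS.orthogonal k (n + 2) (by omega)]
      rcases Nat.lt_succ_iff_lt_or_eq.mp hk with hk1 | rfl
      · rw [hS.orthogonal k (n + 1) (by omega)]
        rcases Nat.lt_succ_iff_lt_or_eq.mp hk1 with hk2 | rfl
        · rw [hS.orthogonal k n (by omega), mul_right_comm, mul_comm, hlow]
          · ring
          · rw [hXdeg]
            exact_mod_cast (by omega : k + 1 < n + 1)
        · rw [ha]
          ring
      · rw [hb, hS.orthogonal (n + 1) n (by omega)]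
        ring
    · rw [← sub_sub, ← sub_sub]
      refine lt_of_le_of_lt (Polynomial.degree_sub_le _ _) (max_lt
        (lt_of_le_of_lt (Polynomial.degree_sub_le _ _) (max_lt (hsub (n + 1)) ?_)) ?_)
      · rw [← Polynomial.smul_eq_C_mul]
        refine lt_of_le_of_lt (Polynomial.degree_smul_le _ _) ?_
        rw [hdeg]
        exact_mod_cast (by omega : n + 1 < n + 2)
      · rw [← Polynomial.smul_eq_C_mul]
        refine lt_of_le_of_lt (Polynomial.degree_smul_le _ _) ?_
        rw [hdeg]
        exact_mod_cast (by omega : n < n + 2)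

end TruncLaguerre

namespace TruncLaguerre

/-! Everything comes from the boundary term at `z`. With w(x) = x^α e^{-x}, the Pearson identity (x
w)' = (α + 1 - x) w, integrated against a polynomial q, leaves only z w(z) q(z)
(`functional_pearson`). Taking q = P_n² and q = P_{n+1} P_n gives the closed forms R_n = -w(z)
P_n(z)²/h_n and r_{n+1} = -w(z) P_{n+1}(z) P_n(z)/h_n (`R_eq`, `r_succ_eq`). Together with a_{n+1} =
h_{n+1}/h_n these give the first difference equation; the second is the three-term recurrence
evaluated at x = z. Modulo the first, the third is equivalent to an equation without the product R_n
R_{n-1} (`linear_difference`), which is proved by induction on n. For the differential system,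
moving the endpoint changes h_n and σ_n by the same boundary values: h_n' = -R_n h_n and σ_n' =
-r_n. Hence the derivatives of a_n and b_n, and then of r_n and R_n; the difference equations bring
them to the stated form. The denominators do not vanish: zeros of P_n cannot lie at z, so R_n < 0.
-/

/-- The Laguerre weight `x^α e^{-x}`. -/
noncomputable def weight (α x : ℝ) : ℝ := x ^ α * Real.exp (-x)

theorem weight_pos (α : ℝ) {x : ℝ} (hx : 0 < x) : 0 < weight α x :=
  mul_pos (Real.rpow_pos_of_pos hx α) (Real.exp_pos _)

/-! ### Integration by parts, orthogonality and positivity at a fixed endpoint. -/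

section FixedEndpoint

variable {α z : ℝ}

theorem functional_add (hα : -1 < α) (p q : ℝ[X]) :
    functional α z (p + q) = functional α z p + functional α z q := by
  obtain ⟨L, hL⟩ := exists_linearMap hα z
  rw [← hL, map_add]

theorem functional_sub (hα : -1 < α) (p q : ℝ[X]) :
    functional α z (p - q) = functional α z p - functional α z q := by
  obtain ⟨L, hL⟩ := exists_linearMap hα z
  rw [← hL, map_sub]

theorem functional_C_mul (hα : -1 < α) (c : ℝ) (p : ℝ[X]) :
    functional α z (Polynomial.C c * p) = c * functional α z p := by
  obtain ⟨L, hL⟩ := exists_linearMap hα z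
  rw [← hL, ← Polynomial.smul_eq_C_mul, map_smul, smul_eq_mul]

/-- Integration by parts for the truncated Laguerre functional. -/
theorem functional_pearson (hα : -1 < α) (hz : 0 < z) (q : ℝ[X]) :
    functional α z ((Polynomial.C (α + 1) - Polynomial.X) * q +
      Polynomial.X * Polynomial.derivative q) = z * weight α z * q.eval z := by
  have hα' : 0 < α + 1 := by linarith
  -- The weight itself may be singular at 0, but x^(α+1) extends continuously by 0 because α + 1 >
  -- 0. Differentiability is then needed only in the open interval, and the boundary term at 0
  -- vanishes.
  have hcont : ContinuousOn (fun x : ℝ => x ^ (α + 1) * Real.exp (-x) * q.eval x)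
      (Set.Icc 0 z) := by
    have h1 : Continuous fun x : ℝ => x ^ (α + 1) := Real.continuous_rpow_const hα'.le
    have h2 : Continuous fun x : ℝ => x ^ (α + 1) * Real.exp (-x) * q.eval x := by fun_prop
    exact h2.continuousOn
  have hderiv : ∀ x ∈ Set.Ioo (0 : ℝ) z,
      HasDerivAt (fun x : ℝ => x ^ (α + 1) * Real.exp (-x) * q.eval x)
        (((Polynomial.C (α + 1) - Polynomial.X) * q +
          Polynomial.X * Polynomial.derivative q).eval x * (x ^ α * Real.exp (-x))) x := by
    intro x hx
    have h1 : HasDerivAt (fun x : ℝ => x ^ (α + 1)) ((α + 1) * x ^ α) x := by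
      simpa using Real.hasDerivAt_rpow_const (x := x) (p := α + 1) (Or.inl hx.1.ne')
    have h2 : HasDerivAt (fun x : ℝ => Real.exp (-x)) (-Real.exp (-x)) x := by
      simpa using (hasDerivAt_neg x).exp
    refine ((h1.mul h2).mul (q.hasDerivAt x)).congr_deriv ?_
    simp only [Polynomial.eval_add, Polynomial.eval_mul, Polynomial.eval_sub, Polynomial.eval_C,
      Polynomial.eval_X, Pi.mul_apply, Real.rpow_add_one hx.1.ne']
    ring
  rw [functional, intervalIntegral.integral_eq_sub_of_hasDerivAt_of_le hz.le hcont hderiv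
    (intervalIntegrable_weight hα z _), Real.zero_rpow hα'.ne', Real.rpow_add_one hz.ne', weight]
  ring

theorem h_pos (hα : -1 < α) (hz : 0 < z) (n : ℕ) : 0 < h α n z :=
  functional_mul_self_pos hα hz ((isSMOP hα hz).monic n).ne_zero

theorem coeff_P_self (hα : -1 < α) (hz : 0 < z) (n : ℕ) : (P α n z).coeff n = 1 := by
  have h1 := (isSMOP hα hz).monic n
  rwa [Polynomial.Monic, Polynomial.leadingCoeff, (isSMOP hα hz).natDegree_eq] at h1

/-- Pairing `P_n` with a polynomial of degree at most `n` extracts the `n`-th coefficient. -/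
theorem functional_P_mul (hα : -1 < α) (hz : 0 < z) {n : ℕ} {p : ℝ[X]} (hp : p.natDegree ≤ n) :
    functional α z (P α n z * p) = p.coeff n * h α n z := by
  have hS := isSMOP hα hz
  have hlt : (p - Polynomial.C (p.coeff n) * P α n z).degree < n := by
    rw [Polynomial.degree_lt_iff_coeff_zero]
    intro m hm
    rcases eq_or_lt_of_le hm with rfl | hlt
    · simp [coeff_P_self hα hz]
    · simp [Polynomial.coeff_eq_zero_of_natDegree_lt (hp.trans_lt hlt),
        Polynomial.coeff_eq_zero_of_natDegree_lt ((hS.natDegree_eq n).trans_lt hlt)]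
  have h0 : functional α z (P α n z * (p - Polynomial.C (p.coeff n) * P α n z)) = 0 := by
    obtain ⟨L, hL⟩ := exists_linearMap hα z
    rw [← hL] at hS ⊢
    exact apply_mul_eq_zero hS.monic hS.natDegree_eq _ n
      (fun k hk => hS.orthogonal k n (by omega)) _ hlt
  rw [mul_sub, functional_sub hα, mul_left_comm, functional_C_mul hα] at h0
  rw [h]
  linarith

theorem natDegree_X_mul_derivative_le (p : ℝ[X]) :
    (Polynomial.X * Polynomial.derivative p).natDegree ≤ p.natDegree := by
  rw [Polynomial.natDegree_le_iff_coeff_eq_zero]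
  intro m hm
  obtain ⟨k, rfl⟩ : ∃ k, m = k + 1 := ⟨m - 1, by omega⟩
  simp [Polynomial.coeff_X_mul, Polynomial.coeff_derivative,
    Polynomial.coeff_eq_zero_of_natDegree_lt hm]

theorem coeff_X_mul_derivative (p : ℝ[X]) (n : ℕ) :
    (Polynomial.X * Polynomial.derivative p).coeff n = n * p.coeff n := by
  cases n with
  | zero => simp
  | succ n =>
    rw [Polynomial.coeff_X_mul, Polynomial.coeff_derivative]
    push_cast
    ring

/-- Needed for (z - x) q², which is nonnegative on the support but is not the square of a
polynomial. -/
theorem functional_pos_of_nonneg (hα : -1 < α) (hz : 0 < z) {p : ℝ[X]} (hp : p ≠ 0)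
    (hnn : ∀ x ∈ Set.Ioc 0 z, 0 ≤ p.eval x) : 0 < functional α z p := by
  rw [functional, intervalIntegral.integral_pos_iff_support_of_nonneg_ae' _
    (intervalIntegrable_weight hα z p)]
  · refine ⟨hz, ?_⟩
    have hfin : (p.roots.toFinset : Set ℝ).Finite := Finset.finite_toSet _
    have hsub : Set.Ioo 0 z \ (p.roots.toFinset : Set ℝ) ⊆
        (Function.support fun x => p.eval x * (x ^ α * Real.exp (-x))) ∩ Set.Ioc 0 z := by
      rintro x ⟨hx, hxr⟩
      have hev : p.eval x ≠ 0 := fun h0 => hxr (by simp [hp, h0])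
      exact ⟨mul_ne_zero hev (weight_pos α hx.1).ne', hx.1, hx.2.le⟩
    refine lt_of_lt_of_le ?_ (MeasureTheory.measure_mono hsub)
    rw [MeasureTheory.measure_sdiff_null (hfin.measure_zero _), Real.volume_Ioo]
    simpa using hz
  · rw [Set.uIoc_of_le hz.le]
    filter_upwards [MeasureTheory.ae_restrict_mem measurableSet_Ioc] with x hx
    exact mul_nonneg (hnn x hx) (weight_pos α hx.1).le

/-- No zero of `P_n` lies at the endpoint of the support. -/
theorem eval_P_ne_zero (hα : -1 < α) (hz : 0 < z) (n : ℕ) : (P α n z).eval z ≠ 0 := by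
  intro h0
  have hS := isSMOP hα hz
  obtain ⟨q, hq⟩ := Polynomial.dvd_iff_isRoot.mpr h0
  have hq0 : q ≠ 0 := by
    rintro rfl
    exact (hS.monic n).ne_zero (by simpa using hq)
  have hdeg : n = 1 + q.natDegree := by
    have := congrArg Polynomial.natDegree hq
    rwa [Polynomial.natDegree_mul (Polynomial.X_sub_C_ne_zero z) hq0, Polynomial.natDegree_X_sub_C,
      hS.natDegree_eq] at this
  -- If P_n = (x - z) q, then q has degree n - 1 and is orthogonal to P_n. But the pairing is, up to
  -- sign, the integral of (z - x) q² against the weight, which is positive.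
  have h1 : functional α z (P α n z * q) = 0 := by
    rw [functional_P_mul hα hz (by omega),
      Polynomial.coeff_eq_zero_of_natDegree_lt (by omega), zero_mul]
  have h2 : functional α z ((Polynomial.C z - Polynomial.X) * (q * q)) = 0 := by
    rw [show (Polynomial.C z - Polynomial.X) * (q * q) = Polynomial.C (-1) * (P α n z * q) by
      rw [hq]; simp only [map_neg, map_one]; ring, functional_C_mul hα, h1, mul_zero]
  refine (functional_pos_of_nonneg hα hz ?_ fun x hx => ?_).ne' h2
  · refine mul_ne_zero ?_ (mul_ne_zero hq0 hq0)
    rw [← neg_sub]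
    exact neg_ne_zero.mpr (Polynomial.X_sub_C_ne_zero z)
  · simp only [Polynomial.eval_mul, Polynomial.eval_sub, Polynomial.eval_C, Polynomial.eval_X]
    exact mul_nonneg (by linarith [hx.2]) (mul_self_nonneg _)

end FixedEndpoint

/-! ### Closed forms of R_n and r_n, and the difference equations. -/

section Difference

variable {α z : ℝ}

theorem a_succ_eq (hα : -1 < α) (hz : 0 < z) (n : ℕ) :
    a α (n + 1) z = h α (n + 1) z / h α n z := by
  rw [a, mul_right_comm, mul_comm, functional_P_mul hα hz, Polynomial.coeff_X_mul,
    coeff_P_self hα hz, one_mul]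
  rw [Polynomial.natDegree_X_mul ((isSMOP hα hz).monic n).ne_zero, (isSMOP hα hz).natDegree_eq]

/-- Integration by parts with q = P_n²: since x P_n' has leading coefficient n, the integral side is
(2n + α + 1 - b_n) h_n, that is, -z R_n h_n. -/
theorem R_eq (hα : -1 < α) (hz : 0 < z) (n : ℕ) :
    R α n z = -(weight α z * (P α n z).eval z ^ 2 / h α n z) := by
  have hh := (h_pos hα hz n).ne'
  have h1 := functional_pearson hα hz (P α n z * P α n z)
  have h2 : functional α z (P α n z * (Polynomial.X * Polynomial.derivative (P α n z))) =
      n * h α n z := by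
    rw [functional_P_mul hα hz ((natDegree_X_mul_derivative_le _).trans
      ((isSMOP hα hz).natDegree_eq n).le), coeff_X_mul_derivative, coeff_P_self hα hz, mul_one]
  have h3 : functional α z (Polynomial.X * P α n z * P α n z) = b α n z * h α n z := by
    rw [b, div_mul_cancel₀ _ hh]
  rw [Polynomial.derivative_mul, show (Polynomial.C (α + 1) - Polynomial.X) *
      (P α n z * P α n z) + Polynomial.X * (Polynomial.derivative (P α n z) * P α n z +
      P α n z * Polynomial.derivative (P α n z)) = Polynomial.C (α + 1) * (P α n z * P α n z) -
      Polynomial.X * P α n z * P α n z + Polynomial.C 2 *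
      (P α n z * (Polynomial.X * Polynomial.derivative (P α n z))) by
    rw [show (Polynomial.C 2 : ℝ[X]) = 2 from rfl]; ring, functional_add hα, functional_sub hα,
    functional_C_mul hα, functional_C_mul hα, h2, h3, Polynomial.eval_mul, ← h] at h1
  rw [R]
  field_simp
  linarith

theorem r_zero : r α 0 z = 0 := by simp [r, a, sigma]

/-- Integration by parts with q = P_{n+1} P_n: the integral side reduces to (σ_{n+1} - a_{n+1}) h_n,
that is, -z r_{n+1} h_n. -/
theorem r_succ_eq (hα : -1 < α) (hz : 0 < z) (n : ℕ) :
    r α (n + 1) z =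
      -(weight α z * (P α (n + 1) z).eval z * (P α n z).eval z / h α n z) := by
  have hS := isSMOP hα hz
  have hh := (h_pos hα hz n).ne'
  have h1 := functional_pearson hα hz (P α (n + 1) z * P α n z)
  have h2 : functional α z
      (P α (n + 1) z * (Polynomial.X * Polynomial.derivative (P α n z))) = 0 := by
    have h4 : (Polynomial.X * Polynomial.derivative (P α n z)).natDegree ≤ n :=
      (natDegree_X_mul_derivative_le _).trans (hS.natDegree_eq n).le
    rw [functional_P_mul hα hz (by omega),
      Polynomial.coeff_eq_zero_of_natDegree_lt (by omega), zero_mul]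
  have h3 : functional α z (Polynomial.X * P α (n + 1) z * P α n z) = a α (n + 1) z * h α n z := by
    rw [a, div_mul_cancel₀ _ hh]
  have h4 : functional α z (P α (n + 1) z * P α n z) = 0 := hS.orthogonal n (n + 1) (by omega)
  -- Subtracting (n + 1) P_{n+1}, which is orthogonal to P_n, removes the leading term of x
  -- P_{n+1}'. What remains has degree at most n, with n-th coefficient -n σ_{n+1} + (n + 1) σ_{n+1}
  -- = σ_{n+1}.
  have h5 : functional α z (P α n z * (Polynomial.X * Polynomial.derivative (P α (n + 1) z) -
      Polynomial.C ((n : ℝ) + 1) * P α (n + 1) z)) = sigma α (n + 1) z * h α n z := by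
    rw [functional_P_mul hα hz]
    · rw [Polynomial.coeff_sub, coeff_X_mul_derivative, Polynomial.coeff_C_mul, sigma]
      ring
    · rw [Polynomial.natDegree_le_iff_coeff_eq_zero]
      intro m hm
      rw [Polynomial.coeff_sub, coeff_X_mul_derivative, Polynomial.coeff_C_mul]
      rcases eq_or_lt_of_le (Nat.succ_le_of_lt hm) with rfl | hlt
      · push_cast
        ring
      · rw [Polynomial.coeff_eq_zero_of_natDegree_lt
          (show (P α (n + 1) z).natDegree < m by rw [hS.natDegree_eq]; exact hlt)]
        ring
  rw [Polynomial.derivative_mul, show (Polynomial.C (α + 1) - Polynomial.X) *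
      (P α (n + 1) z * P α n z) + Polynomial.X * (Polynomial.derivative (P α (n + 1) z) * P α n z +
      P α (n + 1) z * Polynomial.derivative (P α n z)) =
      Polynomial.C (α + 1) * (P α (n + 1) z * P α n z) -
      Polynomial.X * P α (n + 1) z * P α n z +
      P α (n + 1) z * (Polynomial.X * Polynomial.derivative (P α n z)) +
      P α n z * (Polynomial.X * Polynomial.derivative (P α (n + 1) z) -
      Polynomial.C ((n : ℝ) + 1) * P α (n + 1) z) +
      Polynomial.C ((n : ℝ) + 1) * (P α (n + 1) z * P α n z) by ring,
    functional_add hα, functional_add hα, functional_add hα, functional_sub hα,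
    functional_C_mul hα, functional_C_mul hα, h2, h3, h4, h5, Polynomial.eval_mul] at h1
  rw [r]
  field_simp
  linarith

theorem R_neg (hα : -1 < α) (hz : 0 < z) (n : ℕ) : R α n z < 0 := by
  rw [R_eq hα hz, neg_lt_zero]
  have h1 := h_pos hα hz n
  have h2 := weight_pos α hz
  have h3 := eval_P_ne_zero hα hz n
  positivity

theorem b_eq (hz : 0 < z) (n : ℕ) : b α n z = 2 * n + α + 1 + z * R α n z := by
  rw [R, mul_div_cancel₀ _ hz.ne']
  ring

/-- Comparison of the coefficients of x^n in the three-term recurrence. -/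
theorem sigma_succ_sub (hα : -1 < α) (hz : 0 < z) (n : ℕ) :
    sigma α (n + 1) z - sigma α n z = b α n z := by
  cases n with
  | zero =>
    have h1 := congrArg (fun p : ℝ[X] => p.coeff 0) (three_term_recurrence hα hz).1
    simp only [Polynomial.coeff_add, Polynomial.coeff_C_zero, Polynomial.mul_coeff_zero,
      Polynomial.coeff_X_zero, zero_mul, coeff_P_self hα hz 0] at h1
    simp only [sigma, Nat.reduceAdd]
    linarith
  | succ n =>
    have h1 := congrArg (fun p : ℝ[X] => p.coeff (n + 1)) ((three_term_recurrence hα hz).2 n)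
    have h2 : (P α n z).coeff (n + 1) = 0 := Polynomial.coeff_eq_zero_of_natDegree_lt
      (by rw [(isSMOP hα hz).natDegree_eq]; omega)
    simp only [Polynomial.coeff_add, Polynomial.coeff_C_mul, Polynomial.coeff_X_mul,
      coeff_P_self hα hz (n + 1), h2] at h1
    simp only [sigma]
    linarith

theorem r_sq_eq (hα : -1 < α) (hz : 0 < z) (n : ℕ) :
    r α n z ^ 2 = a α n z * R α n z * RPred α n z := by
  cases n with
  | zero => simp [r, a, sigma]
  | succ n =>
    have h1 := (h_pos hα hz n).ne'
    have h2 := (h_pos hα hz (n + 1)).ne'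
    rw [RPred, r_succ_eq hα hz, a_succ_eq hα hz, R_eq hα hz, R_eq hα hz]
    field_simp

/-- The three-term recurrence evaluated at x = z and multiplied by -w(z) P_n(z)/h_n; the term in
P_{n-1} becomes r_n because a_n = h_n/h_{n-1}. -/
theorem r_succ_add (hα : -1 < α) (hz : 0 < z) (n : ℕ) :
    r α (n + 1) z + r α n z = (z - b α n z) * R α n z := by
  have h1 := (h_pos hα hz n).ne'
  cases n with
  | zero =>
    have h2 := congrArg (Polynomial.eval z) (three_term_recurrence hα hz).1
    simp only [Polynomial.eval_add, Polynomial.eval_mul, Polynomial.eval_X,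
      Polynomial.eval_C] at h2
    rw [r_zero, r_succ_eq hα hz, R_eq hα hz,
      show (P α (0 + 1) z).eval z = (z - b α 0 z) * (P α 0 z).eval z by linarith]
    ring
  | succ n =>
    have h2 := congrArg (Polynomial.eval z) ((three_term_recurrence hα hz).2 n)
    have h3 := (h_pos hα hz n).ne'
    simp only [Polynomial.eval_add, Polynomial.eval_mul, Polynomial.eval_X,
      Polynomial.eval_C] at h2
    rw [r_succ_eq hα hz, r_succ_eq hα hz, R_eq hα hz,
      show (P α (n + 1 + 1) z).eval z = (z - b α (n + 1) z) * (P α (n + 1) z).eval z -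
        a α (n + 1) z * (P α n z).eval z by linarith, a_succ_eq hα hz n]
    field_simp
    ring

theorem a_succ_sub (hα : -1 < α) (hz : 0 < z) (n : ℕ) :
    a α (n + 1) z - a α n z = b α n z + z * (r α (n + 1) z - r α n z) := by
  rw [r, r, ← sigma_succ_sub hα hz n]
  field_simp
  ring

/-- The third difference equation, with the quadratic terms cancelled. -/
theorem linear_difference (hα : -1 < α) (hz : 0 < z) (n : ℕ) :
    n * (n + α) + (2 * n + α) * r α n z + a α n z * (R α n z + RPred α n z - 1) = 0 := by
  induction n with
  | zero => simp [r_zero, a]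
  | succ n ih =>
    have h1 := r_succ_add hα hz n
    -- The first difference equation turns R_n times the left side into r_{n+1}² - r_n². One factor
    -- is r_{n+1} + r_n = (z - b_n) R_n, and R_n ≠ 0 cancels.
    have h2 : a α (n + 1) z * R α (n + 1) z - a α n z * RPred α n z =
        (r α (n + 1) z - r α n z) * (z - b α n z) := by
      refine mul_right_cancel₀ (R_neg hα hz n).ne ?_
      have h3 := r_sq_eq hα hz (n + 1)
      rw [RPred] at h3
      linear_combination (-1 : ℝ) * h3 + r_sq_eq hα hz n + (r α (n + 1) z - r α n z) * h1
    have h4 := a_succ_sub hα hz n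
    have h5 := b_eq (α := α) hz n
    rw [RPred]
    push_cast
    rw [h5] at h1 h2 h4
    linear_combination ih + h1 + h2 + (R α n z - 1) * h4

theorem quadratic_difference (hα : -1 < α) (hz : 0 < z) (n : ℕ) :
    (r α n z + n) * (r α n z + n + α) =
      a α n z * (R α n z - 1) * (RPred α n z - 1) := by
  linear_combination linear_difference hα hz n + r_sq_eq hα hz n

end Difference

/-! ### Differentiation of polynomial families and of the functional in the endpoint. -/

/-- The family `p` of polynomials has bounded degree, and its coefficients are differentiable
at `z`, with derivatives the coefficients of `p'`. -/
structure HasCoeffDerivAt (p : ℝ → ℝ[X]) (p' : ℝ[X]) (z : ℝ) : Prop where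
  bounded : ∃ N, ∀ t, (p t).natDegree ≤ N
  coeff : ∀ k, HasDerivAt (fun t => (p t).coeff k) (p'.coeff k) z

section Families

variable {p q : ℝ → ℝ[X]} {p' q' : ℝ[X]} {z : ℝ}

theorem hasCoeffDerivAt_const (p : ℝ[X]) (z : ℝ) : HasCoeffDerivAt (fun _ => p) 0 z :=
  ⟨⟨_, fun _ => le_rfl⟩, fun k => by simpa using hasDerivAt_const z (p.coeff k)⟩

theorem hasCoeffDerivAt_C {f : ℝ → ℝ} {f' : ℝ} (hf : HasDerivAt f f' z) :
    HasCoeffDerivAt (fun t => Polynomial.C (f t)) (Polynomial.C f') z where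
  bounded := ⟨0, fun t => (Polynomial.natDegree_C _).le⟩
  coeff k := by
    cases k with
    | zero => simpa using hf
    | succ k => simpa [Polynomial.coeff_C] using hasDerivAt_const z (0 : ℝ)

theorem HasCoeffDerivAt.add (hp : HasCoeffDerivAt p p' z) (hq : HasCoeffDerivAt q q' z) :
    HasCoeffDerivAt (fun t => p t + q t) (p' + q') z where
  bounded := by
    obtain ⟨M, hM⟩ := hp.bounded
    obtain ⟨N, hN⟩ := hq.bounded
    exact ⟨max M N, fun t => (Polynomial.natDegree_add_le _ _).trans (max_le_max (hM t) (hN t))⟩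
  coeff k := by
    simpa only [Polynomial.coeff_add] using (hp.coeff k).fun_add (hq.coeff k)

theorem HasCoeffDerivAt.mul (hp : HasCoeffDerivAt p p' z) (hq : HasCoeffDerivAt q q' z) :
    HasCoeffDerivAt (fun t => p t * q t) (p' * q z + p z * q') z where
  bounded := by
    obtain ⟨M, hM⟩ := hp.bounded
    obtain ⟨N, hN⟩ := hq.bounded
    exact ⟨M + N, fun t => Polynomial.natDegree_mul_le.trans (add_le_add (hM t) (hN t))⟩
  coeff k := by
    simp only [Polynomial.coeff_add, Polynomial.coeff_mul, ← Finset.sum_add_distrib]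
    exact HasDerivAt.fun_sum fun i _ => (hp.coeff i.1).mul (hq.coeff i.2)

theorem HasCoeffDerivAt.sub (hp : HasCoeffDerivAt p p' z) (hq : HasCoeffDerivAt q q' z) :
    HasCoeffDerivAt (fun t => p t - q t) (p' - q') z where
  bounded := by
    obtain ⟨M, hM⟩ := hp.bounded
    obtain ⟨N, hN⟩ := hq.bounded
    exact ⟨max M N, fun t => (Polynomial.natDegree_sub_le _ _).trans (max_le_max (hM t) (hN t))⟩
  coeff k := by
    simpa only [Polynomial.coeff_sub] using (hp.coeff k).fun_sub (hq.coeff k)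

theorem HasCoeffDerivAt.sum {ι : Type*} (s : Finset ι) {p : ι → ℝ → ℝ[X]} {p' : ι → ℝ[X]}
    (hp : ∀ i ∈ s, HasCoeffDerivAt (p i) (p' i) z) :
    HasCoeffDerivAt (fun t => ∑ i ∈ s, p i t) (∑ i ∈ s, p' i) z := by
  classical
  induction s using Finset.induction_on with
  | empty => simpa using hasCoeffDerivAt_const 0 z
  | insert i s hi ih =>
    simp only [Finset.sum_insert hi]
    exact (hp i (Finset.mem_insert_self i s)).add
      (ih fun j hj => hp j (Finset.mem_insert_of_mem hj))

theorem HasCoeffDerivAt.coeff_eq_zero (hp : HasCoeffDerivAt p p' z) {k : ℕ}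
    (hk : ∀ᶠ t in nhds z, (p t).coeff k = (p z).coeff k) : p'.coeff k = 0 :=
  (hp.coeff k).unique ((hasDerivAt_const z _).congr_of_eventuallyEq hk)

variable {α : ℝ}

theorem hasDerivAt_functional_const (hα : -1 < α) (hz : 0 < z) (p : ℝ[X]) :
    HasDerivAt (fun t => functional α t p) (p.eval z * weight α z) z := by
  have hcont : ContinuousOn (fun x : ℝ => p.eval x * (x ^ α * Real.exp (-x))) (Set.Ioi 0) := by
    intro x hx
    have h1 : ContinuousAt (fun x : ℝ => x ^ α) x :=
      Real.continuousAt_rpow_const x α (Or.inl (Set.mem_Ioi.mp hx).ne')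
    exact (p.continuous.continuousAt.mul
      (h1.mul (Real.continuous_exp.comp continuous_neg).continuousAt)).continuousWithinAt
  exact intervalIntegral.integral_hasDerivAt_right (intervalIntegrable_weight hα z p)
    (hcont.stronglyMeasurableAtFilter isOpen_Ioi z hz) (hcont.continuousAt (Ioi_mem_nhds hz))

theorem functional_eq_sum (hα : -1 < α) {N : ℕ} {p : ℝ[X]} (hp : p.natDegree ≤ N) :
    functional α z p =
      ∑ k ∈ Finset.range (N + 1), p.coeff k * functional α z (Polynomial.X ^ k) := by
  obtain ⟨L, hL⟩ := exists_linearMap hα z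
  conv_lhs => rw [p.as_sum_range' (N + 1) (by omega)]
  simp only [← hL, map_sum, ← Polynomial.C_mul_X_pow_eq_monomial, ← Polynomial.smul_eq_C_mul,
    map_smul, smul_eq_mul]

/-- The uniform degree bound makes the functional a fixed finite sum of coefficients times moments.
The product rule splits the derivative into the variation of the polynomial and the endpoint value
of the integrand. -/
theorem HasCoeffDerivAt.functional (hα : -1 < α) (hz : 0 < z) (hp : HasCoeffDerivAt p p' z) :
    HasDerivAt (fun t => functional α t (p t))
      (functional α z p' + (p z).eval z * weight α z) z := by
  obtain ⟨N, hN⟩ := hp.bounded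
  have hN' : p'.natDegree ≤ N := by
    rw [Polynomial.natDegree_le_iff_coeff_eq_zero]
    intro k hk
    refine hp.coeff_eq_zero (Filter.Eventually.of_forall fun t => ?_)
    rw [Polynomial.coeff_eq_zero_of_natDegree_lt ((hN t).trans_lt hk),
      Polynomial.coeff_eq_zero_of_natDegree_lt ((hN z).trans_lt hk)]
  have h1 : (fun t => TruncLaguerre.functional α t (p t)) = fun t =>
      ∑ k ∈ Finset.range (N + 1), (p t).coeff k *
        TruncLaguerre.functional α t (Polynomial.X ^ k) :=
    funext fun t => functional_eq_sum hα (hN t)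
  rw [h1, functional_eq_sum hα hN', Polynomial.eval_eq_sum_range' (Nat.lt_succ_of_le (hN z)),
    Finset.sum_mul, ← Finset.sum_add_distrib]
  refine HasDerivAt.fun_sum fun k _ => ?_
  refine ((hp.coeff k).mul (hasDerivAt_functional_const hα hz (Polynomial.X ^ k))).congr_deriv ?_
  rw [Polynomial.eval_pow, Polynomial.eval_X]
  ring

theorem exists_hasCoeffDerivAt_P (hα : -1 < α) (hz : 0 < z) (n : ℕ) :
    ∃ p', HasCoeffDerivAt (P α n) p' z := by
  induction n using Nat.strong_induction_on with
  | _ n ih =>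
    have hX := hasCoeffDerivAt_const (Polynomial.X ^ n) z
    have key : ∀ k : Fin n, ∃ p', HasCoeffDerivAt (fun t => Polynomial.C
        (TruncLaguerre.functional α t (Polynomial.X ^ n * P α k t) /
          TruncLaguerre.functional α t (P α k t * P α k t)) * P α k t) p' z := by
      intro k
      obtain ⟨p', hp'⟩ := ih k k.2
      exact ⟨_, (hasCoeffDerivAt_C (((hX.mul hp').functional hα hz).div
        ((hp'.mul hp').functional hα hz) (h_pos hα hz k).ne')).mul hp'⟩
    choose p' hp' using key
    -- The Gram-Schmidt formula holds for every real t, also for t ≤ 0 where orthogonality may fail,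
    -- so it yields the degree bound for all t as well as differentiability at z.
    have h1 : P α n = fun t => Polynomial.X ^ n - ∑ k : Fin n, Polynomial.C
        (TruncLaguerre.functional α t (Polynomial.X ^ n * P α k t) /
          TruncLaguerre.functional α t (P α k t * P α k t)) * P α k t := by
      funext t
      rw [P, monicOP]
      rfl
    rw [h1]
    exact ⟨_, hX.sub (HasCoeffDerivAt.sum Finset.univ fun k _ => hp' k)⟩

end Families

/-! ### Derivatives in z of h_n, σ_n, a_n, b_n, and of R_n and r_n. -/

section Differential

variable {α z : ℝ}

/-- For t > 0 the polynomial stays monic of degree n, so its coefficients from index n on are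
constant near z. The z-derivative of P_n thus has degree below n. -/
theorem HasCoeffDerivAt.coeff_P_eq_zero (hα : -1 < α) (hz : 0 < z) {n : ℕ} {p' : ℝ[X]}
    (hp : HasCoeffDerivAt (P α n) p' z) {k : ℕ} (hk : n ≤ k) : p'.coeff k = 0 := by
  have h1 : ∀ t, 0 < t → (P α n t).coeff k = if k = n then 1 else 0 := by
    intro t ht
    split_ifs with h2
    · rw [h2, coeff_P_self hα ht]
    · exact Polynomial.coeff_eq_zero_of_natDegree_lt
        (by rw [(isSMOP hα ht).natDegree_eq]; omega)
  refine hp.coeff_eq_zero ?_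
  filter_upwards [Ioi_mem_nhds hz] with t ht
  rw [h1 t ht, h1 z hz]

/-- The z-derivative of P_n has lower degree and is orthogonal to P_n, so only the endpoint term
w(z) P_n(z)² survives. -/
theorem hasDerivAt_h (hα : -1 < α) (hz : 0 < z) (n : ℕ) :
    HasDerivAt (h α n) (-(R α n z * h α n z)) z := by
  obtain ⟨p', hp'⟩ := exists_hasCoeffDerivAt_P hα hz n
  have h1 : TruncLaguerre.functional α z (P α n z * p') = 0 := by
    rw [functional_P_mul hα hz, hp'.coeff_P_eq_zero hα hz le_rfl, zero_mul]
    exact Polynomial.natDegree_le_iff_coeff_eq_zero.mpr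
      fun k hk => hp'.coeff_P_eq_zero hα hz hk.le
  refine ((hp'.mul hp').functional hα hz).congr_deriv ?_
  have hh := (h_pos hα hz n).ne'
  rw [functional_add hα, mul_comm p', h1, R_eq hα hz, Polynomial.eval_mul]
  field_simp
  ring

/-- For positive index, this is the derivative of the relation ⟨ℓ, P_{n+1} P_n⟩ = 0: the variation
of P_n drops out, that of P_{n+1} contributes -σ_{n+1}' h_n, and the endpoint term balances it. -/
theorem hasDerivAt_sigma (hα : -1 < α) (hz : 0 < z) (n : ℕ) :
    HasDerivAt (sigma α n) (-r α n z) z := by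
  cases n with
  | zero =>
    rw [r_zero, neg_zero]
    exact hasDerivAt_const z 0
  | succ n =>
    obtain ⟨p', hp'⟩ := exists_hasCoeffDerivAt_P hα hz (n + 1)
    obtain ⟨q', hq'⟩ := exists_hasCoeffDerivAt_P hα hz n
    have h1 : TruncLaguerre.functional α z (P α n z * p') = p'.coeff n * h α n z :=
      functional_P_mul hα hz (Polynomial.natDegree_le_iff_coeff_eq_zero.mpr
        fun k hk => hp'.coeff_P_eq_zero hα hz hk)
    have h2 : TruncLaguerre.functional α z (P α (n + 1) z * q') = 0 := by
      rw [functional_P_mul hα hz, hq'.coeff_P_eq_zero hα hz (Nat.le_succ n), zero_mul]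
      exact Polynomial.natDegree_le_iff_coeff_eq_zero.mpr
        fun k hk => hq'.coeff_P_eq_zero hα hz (by omega)
    have h3 := ((hp'.mul hq').functional hα hz).unique
      ((hasDerivAt_const z (0 : ℝ)).congr_of_eventuallyEq (by
        filter_upwards [Ioi_mem_nhds hz] with t ht
        exact (isSMOP hα ht).orthogonal n (n + 1) (by omega)))
    rw [functional_add hα, mul_comm p', h1, h2, Polynomial.eval_mul] at h3
    refine (hp'.coeff n).neg.congr_deriv ?_
    have hh := (h_pos hα hz n).ne'
    rw [r_succ_eq hα hz]
    field_simp
    linarith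

theorem hasDerivAt_a (hα : -1 < α) (hz : 0 < z) (n : ℕ) :
    HasDerivAt (a α n) (a α n z * (RPred α n z - R α n z)) z := by
  cases n with
  | zero =>
    rw [a, zero_mul]
    exact hasDerivAt_const z 0
  | succ n =>
    have h0 := (h_pos hα hz n).ne'
    refine (((hasDerivAt_h hα hz (n + 1)).div (hasDerivAt_h hα hz n) h0).congr_of_eventuallyEq
      (f₁ := a α (n + 1)) ?_).congr_deriv ?_
    · filter_upwards [Ioi_mem_nhds hz] with t ht
      exact a_succ_eq hα ht n
    · rw [a_succ_eq hα hz, RPred]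
      field_simp
      ring

theorem hasDerivAt_b (hα : -1 < α) (hz : 0 < z) (n : ℕ) :
    HasDerivAt (b α n) (r α n z - r α (n + 1) z) z := by
  refine (((hasDerivAt_sigma hα hz (n + 1)).sub
    (hasDerivAt_sigma hα hz n)).congr_of_eventuallyEq ?_).congr_deriv (by ring)
  filter_upwards [Ioi_mem_nhds hz] with t ht
  exact (sigma_succ_sub hα ht n).symm

theorem hasDerivAt_R (hα : -1 < α) (hz : 0 < z) (n : ℕ) :
    HasDerivAt (R α n)
      ((2 * r α n z + (2 * n + α - z + z * R α n z) * R α n z) / z) z := by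
  refine (((hasDerivAt_b hα hz n).sub_const (2 * n + α + 1)).div (hasDerivAt_id z)
    hz.ne').congr_deriv ?_
  -- The derivative of b_n involves r_{n+1}; the second difference equation eliminates it.
  have h1 := r_succ_add hα hz n
  have h2 := b_eq (α := α) hz n
  have hz' := hz.ne'
  rw [h2] at h1 ⊢
  simp only [id]
  field_simp
  linear_combination (-z) * h1

/-- In the quotient rule for (a_n - σ_n)/z, the contribution -σ_n' = r_n cancels the one from
differentiating 1/z. -/
theorem hasDerivAt_r (hα : -1 < α) (hz : 0 < z) (n : ℕ) :
    HasDerivAt (r α n) (a α n z * (RPred α n z - R α n z) / z) z := by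
  refine (((hasDerivAt_a hα hz n).sub (hasDerivAt_sigma hα hz n)).div (hasDerivAt_id z)
    hz.ne').congr_deriv ?_
  have h1 : a α n z - sigma α n z = z * r α n z := by
    rw [r, mul_div_cancel₀ _ hz.ne']
  have hz' := hz.ne'
  simp only [id, Pi.sub_apply, h1]
  field_simp
  ring

end Differential
end TruncLaguerre

theorem mainTheorem6 (α : ℝ) (hα : -1 < α) :
    -- the three difference equations, for every order and every endpoint
    (∀ (n : ℕ) (z : ℝ), 0 < z →
      TruncLaguerre.r α n z ^ 2 =
          TruncLaguerre.a α n z * TruncLaguerre.R α n z * TruncLaguerre.RPred α n z ∧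
      TruncLaguerre.r α (n + 1) z + TruncLaguerre.r α n z =
          -(2 * n + 1 + α - z + z * TruncLaguerre.R α n z) * TruncLaguerre.R α n z ∧
      (TruncLaguerre.r α n z + n) * (TruncLaguerre.r α n z + n + α) =
          TruncLaguerre.a α n z * (TruncLaguerre.R α n z - 1) *
            (TruncLaguerre.RPred α n z - 1)) ∧
    -- the differential system, with the facts that give it a meaning
    (∀ (n : ℕ) (z : ℝ), 0 < z →
      DifferentiableAt ℝ (TruncLaguerre.R α n) z ∧
      DifferentiableAt ℝ (TruncLaguerre.r α n) z ∧
      TruncLaguerre.R α n z ≠ 0 ∧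
      TruncLaguerre.R α n z ≠ 1 ∧
      TruncLaguerre.theta (TruncLaguerre.R α n) z =
          2 * TruncLaguerre.r α n z +
            (2 * n + α - z + z * TruncLaguerre.R α n z) * TruncLaguerre.R α n z ∧
      TruncLaguerre.theta (TruncLaguerre.r α n) z =
          n * (n + α) + (2 * n + α) * TruncLaguerre.r α n z +
            TruncLaguerre.r α n z ^ 2 / TruncLaguerre.R α n z +
            (n + TruncLaguerre.r α n z) * (n + α + TruncLaguerre.r α n z) /
              (TruncLaguerre.R α n z - 1)) := by
  refine ⟨fun n z hz => ⟨TruncLaguerre.r_sq_eq hα hz n, ?_,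
    TruncLaguerre.quadratic_difference hα hz n⟩, fun n z hz => ?_⟩
  · rw [TruncLaguerre.r_succ_add hα hz, TruncLaguerre.b_eq hz]
    ring
  · have hR := TruncLaguerre.R_neg hα hz n
    have hR1 : TruncLaguerre.R α n z - 1 ≠ 0 := by linarith
    have hdR := TruncLaguerre.hasDerivAt_R hα hz n
    have hdr := TruncLaguerre.hasDerivAt_r hα hz n
    refine ⟨hdR.differentiableAt, hdr.differentiableAt, hR.ne, by linarith, ?_, ?_⟩
    · rw [TruncLaguerre.theta, hdR.deriv, mul_div_cancel₀ _ hz.ne']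
    -- The first and third difference equations clear the two quotients. The claim becomes a_n
    -- (R_{n-1} - R_n) = n(n + α) + (2n + α) r_n + a_n (2 R_{n-1} - 1), which is
    -- `linear_difference`.
    · have h1 : TruncLaguerre.r α n z ^ 2 / TruncLaguerre.R α n z =
          TruncLaguerre.a α n z * TruncLaguerre.RPred α n z := by
        rw [TruncLaguerre.r_sq_eq hα hz, div_eq_iff hR.ne]
        ring
      have h2 : (n + TruncLaguerre.r α n z) * (n + α + TruncLaguerre.r α n z) /
          (TruncLaguerre.R α n z - 1) =
          TruncLaguerre.a α n z * (TruncLaguerre.RPred α n z - 1) := by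
        rw [div_eq_iff hR1]
        linear_combination TruncLaguerre.quadratic_difference hα hz n
      rw [TruncLaguerre.theta, hdr.deriv, mul_div_cancel₀ _ hz.ne', h1, h2]
      linear_combination (-1 : ℝ) * TruncLaguerre.linear_difference hα hz n
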